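/- Let $T,R>0$ and let $g_i(t)=\sum_{j,k}(g_i)_{jk}(t,z)\,dz_j\,dz_k$, $i=1,2$, be two smooth families ($t\in\mathbb R$) of Riemannian metrics on $\mathbb R^n$ that coincide with the Euclidean metric $g_0$ wherever $|z|\ge R$ or $|t|\ge T$. Assume that each $g_i(t)$ is non-trapping: its geodesics leave every compact subset of $\mathbb R^n$ in finite time. Write $|\zeta|^2_{g(t)}=\sum_{j,k} g^{jk}(t,z)\zeta_j\zeta_k$ for the dual metric. *Classical scattering map at the boundary.* Let ${}^{1c}T^*_{\partial\overline{\mathbb R^n}}\mathbb R^n$ be the restriction of the 1-cusp cotangent bundle of the radial compactification $\overline{\mathbb R^n}$ to its boundary; its points are $q=(y,\xi,\eta)$ with $y\in\mathbb S^{n-1}$, $\xi\in\mathbb R$, $\eta\in y^\perp\cong T^*_y\mathbb S^{n-1}$, representing the covector $\xi\,\frac{dx}{x^3}+\eta\cdot\frac{dy}{x}$ with $x=1/|Z|$, $y=Z/|Z|$. The bicharacteristics of $D_t+\Delta_{g(t)}$ at fibre infinity are the curves $(t,z(s),\hat\zeta(s))$, $s\in\mathbb R$, in a fixed time slice, with $|\hat\zeta|_{g(t)}=1$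 and $\dot z=\partial_{\zeta}|\hat\zeta|_{g(t)}^2$, $\dot{\hat\zeta}=-\partial_z|\hat\zeta|^2_{g(t)}$. Such a curve has backward (respectively forward) endpoint $q=(y,\xi,\eta)$ if, as $s\to-\infty$ (respectively $s\to+\infty$), $|z|\to\infty$, $\hat\zeta\to y$, and $z+|z|\hat\zeta\to-\eta$ (respectively $z-|z|\hat\zeta\to-\eta$), and if $\xi=-2t$. The map $\mathfrak{Cl}_g$ on ${}^{1c}T^*_{\partial\overline{\mathbb R^n}}\mathbb R^n$ sends the backward endpoint of each such bicharacteristic to its forward endpoint. *Truncated scattering relation.* Let $\partial_-\mathfrak B$ (respectively $\partial_+\mathfrak B$) be the set of $(t,z,v)$ with $t\in[-T,T]$, $|z|=R$, $|v|=1$ and $z\cdot v<0$ (respectively $z\cdot v>0$), i.e. the inward (respectively outward) boundary of $[-T,T]\times S^*B_R(0)$. For $(t,z,v)\in\partial_-\mathfrak B$ let $\mathfrak{Cl}^R_g(t,z,v)=(t,z',v')\in\partial_+\mathfrak B$, where $(z',v')$ is the point of the unit speed geodesic of $g(t)$ starting from $(z,v)$, lifted to the unit cosphere bundle, at which it reaches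 $\partial B_R(0)$ for the first time after the start. If $\mathfrak{Cl}_{g_1}=\mathfrak{Cl}_{g_2}$ on ${}^{1c}T^*_{\partial\overline{\mathbb R^n}}\mathbb R^n$, then $\mathfrak{Cl}^R_{g_1}$ and $\mathfrak{Cl}^R_{g_2}$ are well-defined maps $\partial_-\mathfrak B\to\partial_+\mathfrak B$ and $\mathfrak{Cl}^R_{g_1}=\mathfrak{Cl}^R_{g_2}$. -/

import Mathlib

open Filter Topology Set
open scoped ContDiff

noncomputable section

/-- `ℝⁿ` with its Euclidean inner product. Covectors `ζ · dz` on `ℝⁿ` are written through their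
components, so they are elements of the same space. -/
abbrev E (n : ℕ) := EuclideanSpace ℝ (Fin n)

/-- A smooth family `g(t) = ∑ gᵢⱼ(t, z) dzᵢ dzⱼ`, `t ∈ ℝ`, of Riemannian metrics on `ℝⁿ`. -/
structure MetricFamily (n : ℕ) where
  /-- the matrix `(gᵢⱼ(t, z))` -/
  coeff : ℝ → E n → Matrix (Fin n) (Fin n) ℝ
  smooth : ∀ i j, ContDiff ℝ ∞ (fun p : ℝ × E n => coeff p.1 p.2 i j)
  posDef : ∀ t z, (coeff t z).PosDef

namespace MetricFamily

variable {n : ℕ}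

/-- `g(t)` is the flat metric wherever `|z| ≥ R` or `|t| ≥ T`; thus `g - g₀` is compactly supported
in spacetime, and `R`, `T` are constants that witness it. -/
def IsFlatOutside (g : MetricFamily n) (T R : ℝ) : Prop :=
  ∀ t z, (R ≤ ‖z‖ ∨ T ≤ |t|) → g.coeff t z = 1

/-- The dual metric function `|ζ|²_{g(t)} = ∑ gⁱʲ(t, z) ζᵢ ζⱼ` on the cotangent bundle. -/
def cometric (g : MetricFamily n) (t : ℝ) (z ζ : E n) : ℝ :=
  ∑ i, ∑ j, (g.coeff t z)⁻¹ i j * ζ i * ζ j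

end MetricFamily

/-- `s ↦ (z s, ζ s)` solves Hamilton's equations `z' = ∂H/∂ζ`, `ζ' = -∂H/∂z` on `I ⊆ ℝ`. -/
def IsHamiltonCurveOn {n : ℕ} (H : E n → E n → ℝ) (I : Set ℝ) (z ζ : ℝ → E n) : Prop :=
  ∀ s ∈ I, HasDerivWithinAt z (gradient (fun w => H (z s) w) (ζ s)) I s ∧
    HasDerivWithinAt ζ (-gradient (fun x => H x (ζ s)) (z s)) I s

namespace MetricFamily

variable {n : ℕ}

/-- Unit speed geodesics of `g(t)`, lifted to the unit cosphere bundle `S^*_{g(t)} ℝⁿ`: the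
Hamilton flow of `|ζ|²_{g(t)} / 2`. -/
def IsLiftedGeodesicOn (g : MetricFamily n) (t : ℝ) (I : Set ℝ) (z ζ : ℝ → E n) : Prop :=
  IsHamiltonCurveOn (fun x w => g.cometric t x w / 2) I z ζ ∧ ∀ s ∈ I, g.cometric t (z s) (ζ s) = 1

/-- Each `g(t)` is non-trapping: its geodesics leave any compact set in finite time. -/
def NonTrapping (g : MetricFamily n) : Prop :=
  ∀ (t : ℝ) (z ζ : ℝ → E n), g.IsLiftedGeodesicOn t univ z ζ →
    ∀ K : Set (E n), IsCompact K → ∃ s > 0, z s ∉ K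

/-- Bicharacteristics, over finite points of spacetime, inside fibre infinity of the parabolically
compactified cotangent bundle of `ℝⁿ⁺¹`, for the symbol `p = τ + |ζ|²_{g(t)}` of
`D_t + Δ_{g(t)} + V`.  With `ρ = |ζ|_g⁻¹`, `τ̂ = ρ² τ`, `ζ̂ = ρ ζ` one has `ρ = 0`, `|ζ̂|_g = 1`, and
`τ̂ = -1` on the characteristic variety, and `ρ H_p` restricts to
`∂_ζ p(ζ̂) · ∂_z - ∂_z p(ζ̂) · ∂_ζ̂`; in particular `t` is constant along the flow (and `V` does not
enter).  In the definition `ζ` stands for `ζ̂`. -/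
def IsBicharacteristicAtFibreInfinity (g : MetricFamily n) (t : ℝ) (z ζ : ℝ → E n) : Prop :=
  IsHamiltonCurveOn (g.cometric t) univ z ζ ∧ ∀ s, g.cometric t (z s) (ζ s) = 1

end MetricFamily

/-- The 1-cusp cotangent bundle of the radial compactification of `ℝⁿ`, restricted to the boundary
sphere at infinity.  A point is a boundary point `y ∈ 𝕊ⁿ⁻¹` with the 1-cusp covector
`ξ dx/x³ + η · dy/x`, where `x = 1/|Z|`, `y = Z/|Z|`, and the covector `η` on the sphere is written
through `T_y^* 𝕊ⁿ⁻¹ = y^⊥ ⊆ ℝⁿ`. -/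
@[ext]
structure OneCuspBoundary (n : ℕ) where
  y : E n
  ξ : ℝ
  η : E n
  norm_y : ‖y‖ = 1
  orth : inner ℝ y η = 0

/-- The bicharacteristic `(t, z(s), ζ(s))` at fibre infinity tends, in the backward direction, to
the point `q` of the front face `W_-` of the blow-up of the source radial set
`{1/|z| = 0, t/|z| = -ρ/2, ζ/|ζ| = -z/|z|}`.  At `ρ = 0` the projective coordinates of the blow-up
along the front face are `(t/|z|)/(1/|z|) = t` and `(ζ + z/|z|)/(1/|z|) = z + |z| ζ`, and the front
face is identified with the 1-cusp cotangent bundle through `y = ζ`, `ξ = -2 t`,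
`η = - lim (z + |z| ζ)`. -/
def TendsToBackward {n : ℕ} (t : ℝ) (z ζ : ℝ → E n) (q : OneCuspBoundary n) : Prop :=
  Tendsto (fun s => ‖z s‖) atBot atTop ∧ Tendsto ζ atBot (𝓝 q.y) ∧ q.ξ = -2 * t ∧
    Tendsto (fun s => z s + ‖z s‖ • ζ s) atBot (𝓝 (-q.η))

/-- The analogue of `TendsToBackward` in the forward direction, at the front face `W_+` of the
blow-up of the sink `{1/|z| = 0, t/|z| = ρ/2, ζ/|ζ| = z/|z|}`. -/
def TendsToForward {n : ℕ} (t : ℝ) (z ζ : ℝ → E n) (q : OneCuspBoundary n) : Prop :=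
  Tendsto (fun s => ‖z s‖) atTop atTop ∧ Tendsto ζ atTop (𝓝 q.y) ∧ q.ξ = -2 * t ∧
    Tendsto (fun s => z s - ‖z s‖ • ζ s) atTop (𝓝 (-q.η))

/-- The inward part `∂₋𝔅` of the restriction to `∂B_R(0)` of `𝔅 = [-T, T] × S^*B_R(0)`; points are
`(t, z, v)`.  The metrics considered are flat over `∂B_R(0)`, so that the Euclidean norm and inner
product are used. -/
def InwardBoundary (n : ℕ) (T R : ℝ) : Set (ℝ × E n × E n) :=
  {p | p.1 ∈ Icc (-T) T ∧ ‖p.2.1‖ = R ∧ ‖p.2.2‖ = 1 ∧ inner ℝ p.2.1 p.2.2 < 0}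

/-- The outward part `∂₊𝔅`. -/
def OutwardBoundary (n : ℕ) (T R : ℝ) : Set (ℝ × E n × E n) :=
  {p | p.1 ∈ Icc (-T) T ∧ ‖p.2.1‖ = R ∧ ‖p.2.2‖ = 1 ∧ 0 < inner ℝ p.2.1 p.2.2}

namespace MetricFamily

variable {n : ℕ}

/-- The graph of the classical scattering map `Cl_g` over the boundary part of the 1-cusp cotangent
bundle: `Cl_g(q) = q'` when some bicharacteristic tends to `q` in the backward and to `q'` in the
forward direction. -/
def ClassicalScattering (g : MetricFamily n) (q q' : OneCuspBoundary n) : Prop :=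
  ∃ (t : ℝ) (z ζ : ℝ → E n), g.IsBicharacteristicAtFibreInfinity t z ζ ∧
    TendsToBackward t z ζ q ∧ TendsToForward t z ζ q'

/-- The graph of the `R`-truncated scattering relation `Cl_g^R : (t, z, v) ↦ (t, z', v')`: the unit
speed lifted geodesic of `g(t)` from `(z, v)` reaches `∂B_R(0)` for the first time at `(z', v')`
(after the length `ℓ`). -/
def TruncatedScattering (g : MetricFamily n) (T R : ℝ)
    (p : InwardBoundary n T R) (p' : OutwardBoundary n T R) : Prop :=
  p'.1.1 = p.1.1 ∧ ∃ ℓ > 0, ∃ z ζ : ℝ → E n, g.IsLiftedGeodesicOn p.1.1 (Icc 0 ℓ) z ζ ∧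
    (z 0, ζ 0) = p.1.2 ∧ (z ℓ, ζ ℓ) = p'.1.2 ∧ ∀ s ∈ Ioo 0 ℓ, ‖z s‖ < R

end MetricFamily

end

/-!
Outside the ball `B_R(0)` the geodesics are straight lines. A line leaving the ball is determined by
its endpoint at infinity: `ξ` gives the time, `y` the direction and `η` the foot of the
perpendicular from the origin, and the point of exit is the one on the sphere that moves outwards.
Hence `p` and `p'` are related by the truncated scattering relation precisely when the endpoints at
infinity of the exterior half-lines through `p` and `p'` are related by the classical scattering
map. Non-trapping makes the truncated relation total, and uniqueness for the geodesic flow makes it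
single-valued.
-/

section IntegralCurves

variable {V : Type*} [NormedAddCommGroup V] [NormedSpace ℝ V] {X : V → V}

theorem eqOn_of_isIntegralCurveOn_of_locallyLipschitz (hX : LocallyLipschitz X) {I : Set ℝ}
    [I.OrdConnected] {γ γ' : ℝ → V} (hγ : IsIntegralCurveOn γ (fun _ ↦ X) I)
    (hγ' : IsIntegralCurveOn γ' (fun _ ↦ X) I) {s₀ : ℝ} (hs₀ : s₀ ∈ I) (h : γ s₀ = γ' s₀) :
    EqOn γ γ' I := by
  have hlip (a b : ℝ) (hab : Icc a b ⊆ I) :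
      ∃ K, LipschitzOnWith K X (γ '' Icc a b ∪ γ' '' Icc a b) :=
    (hX.locallyLipschitzOn).exists_lipschitzOnWith_of_compact
      ((isCompact_Icc.image_of_continuousOn (hγ.mono hab).continuousOn).union
        (isCompact_Icc.image_of_continuousOn (hγ'.mono hab).continuousOn))
  intro s hs
  rcases le_total s₀ s with hle | hle
  · have hsub : Icc s₀ s ⊆ I := OrdConnected.out ‹_› hs₀ hs
    obtain ⟨K, hK⟩ := hlip _ _ hsub
    have hderiv {δ : ℝ → V} (hδ : IsIntegralCurveOn δ (fun _ ↦ X) I) (u : ℝ) (hu : u ∈ Ico s₀ s) :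
        HasDerivWithinAt δ (X (δ u)) (Ici u) u :=
      (hδ.mono hsub u (Ico_subset_Icc_self hu)).mono_of_mem_nhdsWithin (Icc_mem_nhdsGE_of_mem hu)
    exact ODE_solution_unique_of_mem_Icc_right (fun _ _ ↦ hK) (hγ.mono hsub).continuousOn
      (hderiv hγ) (fun u hu ↦ .inl (mem_image_of_mem γ (Ico_subset_Icc_self hu)))
      (hγ'.mono hsub).continuousOn (hderiv hγ')
      (fun u hu ↦ .inr (mem_image_of_mem γ' (Ico_subset_Icc_self hu))) h (right_mem_Icc.2 hle)
  · have hsub : Icc s s₀ ⊆ I := OrdConnected.out ‹_› hs hs₀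
    obtain ⟨K, hK⟩ := hlip _ _ hsub
    have hderiv {δ : ℝ → V} (hδ : IsIntegralCurveOn δ (fun _ ↦ X) I) (u : ℝ) (hu : u ∈ Ioc s s₀) :
        HasDerivWithinAt δ (X (δ u)) (Iic u) u :=
      (hδ.mono hsub u (Ioc_subset_Icc_self hu)).mono_of_mem_nhdsWithin (Icc_mem_nhdsLE_of_mem hu)
    exact ODE_solution_unique_of_mem_Icc_left (fun _ _ ↦ hK) (hγ.mono hsub).continuousOn
      (hderiv hγ) (fun u hu ↦ .inl (mem_image_of_mem γ (Ioc_subset_Icc_self hu)))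
      (hγ'.mono hsub).continuousOn (hderiv hγ')
      (fun u hu ↦ .inr (mem_image_of_mem γ' (Ioc_subset_Icc_self hu))) h (left_mem_Icc.2 hle)

theorem exists_isIntegralCurveOn_Icc_of_lipschitzWith [CompleteSpace V] {K : NNReal}
    (hX : LipschitzWith K X) (p : V) :
    ∃ γ : ℝ → V, γ 0 = p ∧
      IsIntegralCurveOn γ (fun _ ↦ X) (Icc (-(1 + K : ℝ)⁻¹) (1 + K : ℝ)⁻¹) := by
  have hbound (q : V) (hq : q ∈ Metric.closedBall p ‖X p‖₊) :
      ‖X q‖ ≤ ((1 + K) * ‖X p‖₊ : NNReal) :=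
    calc ‖X q‖ ≤ ‖X p‖ + ‖X q - X p‖ := norm_le_norm_add_norm_sub' _ _
      _ ≤ ‖X p‖ + K * ‖X p‖ := by
        grw [hX.norm_sub_le, ← dist_eq_norm, Metric.mem_closedBall.1 hq, coe_nnnorm]
      _ = ((1 + K) * ‖X p‖₊ : NNReal) := by push_cast; ring
  have hε : 0 ≤ (1 + K : ℝ)⁻¹ := by positivity
  have hpl : IsPicardLindelof (fun _ ↦ X) ⟨(0 : ℝ), neg_nonpos.2 hε, hε⟩ p ‖X p‖₊ 0
      ((1 + K) * ‖X p‖₊) K :=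
    .of_time_independent hbound hX.lipschitzOnWith (by
      have hmul : (1 + K : ℝ) * ‖X p‖ * (1 + K : ℝ)⁻¹ = ‖X p‖ := by field_simp
      simp [hmul])
  exact hpl.exists_eq_forall_mem_Icc_hasDerivWithinAt₀

theorem exists_isIntegralCurve_of_contDiff_of_lipschitzWith [CompleteSpace V] {K : NNReal}
    (hX : ContDiff ℝ 1 X) (hK : LipschitzWith K X) (p : V) :
    ∃ γ : ℝ → V, γ 0 = p ∧ IsIntegralCurve γ (fun _ ↦ X) := by
  have hlocal (q : V) : ∃ γ : ℝ → V, γ 0 = q ∧ IsMIntegralCurveOn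
      (I := modelWithCornersSelf ℝ V) γ X (Ioo (-(1 + K : ℝ)⁻¹) (1 + K : ℝ)⁻¹) := by
    obtain ⟨γ, hγ₀, hγ⟩ := exists_isIntegralCurveOn_Icc_of_lipschitzWith hK q
    exact ⟨γ, hγ₀, fun s hs ↦
      (hγ.mono Ioo_subset_Icc_self s hs).hasFDerivWithinAt.hasMFDerivWithinAt⟩
  obtain ⟨γ, hγ₀, hγ⟩ := exists_isMIntegralCurve_of_isMIntegralCurveOn
    (contMDiff_vectorSpace_iff_contDiff.2 hX) (by positivity) hlocal p
  exact ⟨γ, hγ₀, fun s ↦ (hγ s).hasFDerivAt⟩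

end IntegralCurves

section NormedSpace

theorem compl_ball_subset_closure_interior_compl_ball {F : Type*} [NormedAddCommGroup F]
    [NormedSpace ℝ F] (x : F) (r : ℝ) :
    (Metric.ball x r)ᶜ ⊆ closure (interior (Metric.ball x r)ᶜ) := by
  rcases eq_or_ne r 0 with rfl | hr
  · simp
  · rw [interior_compl, closure_compl, closure_ball x hr, interior_closedBall x hr]

theorem exists_first_hit {f : ℝ → ℝ} {a b r : ℝ} (hf : Continuous f)
    (ha : ∀ᶠ s in 𝓝[>] a, f s < r) (hab : a < b) (hb : r ≤ f b) :
    ∃ ℓ > a, f ℓ = r ∧ ∀ s ∈ Ioo a ℓ, f s < r := by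
  obtain ⟨δ, hδ, hlt⟩ := mem_nhdsGT_iff_exists_Ioo_subset.1 ha
  have hδ' : a < δ := hδ
  set S := {s | δ ≤ s ∧ r ≤ f s}
  have hclosed : IsClosed S := isClosed_Ici.inter (isClosed_le continuous_const hf)
  have hbdd : BddBelow S := ⟨δ, fun _ hs ↦ hs.1⟩
  have hne : S.Nonempty := ⟨b, le_of_not_gt fun h ↦ (hlt ⟨hab, h⟩).not_ge hb, hb⟩
  have hmem : sInf S ∈ S := hclosed.csInf_mem hne hbdd
  have haℓ : a < sInf S := hδ'.trans_le hmem.1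
  have hbefore (s : ℝ) (hs : s ∈ Ioo a (sInf S)) : f s < r := by
    by_contra! hge
    rcases lt_or_ge s δ with h | h
    · exact (hlt ⟨hs.1, h⟩).not_ge hge
    · exact hs.2.not_ge (csInf_le hbdd ⟨h, hge⟩)
  refine ⟨sInf S, haℓ, le_antisymm ?_ hmem.2, hbefore⟩
  refine le_of_tendsto (hf.continuousWithinAt (s := Iio (sInf S))) ?_
  filter_upwards [Ioo_mem_nhdsLT haℓ] with s hs using (hbefore s hs).le

theorem eventually_norm_lt_of_inner_neg {F : Type*} [NormedAddCommGroup F] [InnerProductSpace ℝ F]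
    {z : ℝ → F} {v : F} {a : ℝ} (hz : HasDerivWithinAt z v (Ioi a) a) (hv : inner ℝ (z a) v < 0) :
    ∀ᶠ s in 𝓝[>] a, ‖z s‖ < ‖z a‖ := by
  have hslope : Tendsto (slope (‖z ·‖ ^ 2) a) (𝓝[>] a) (𝓝 (2 * inner ℝ (z a) v)) :=
    (hasDerivWithinAt_iff_tendsto_slope' self_notMem_Ioi).1 hz.norm_sq
  filter_upwards [hslope.eventually_lt_const (mul_neg_of_pos_of_neg two_pos hv),
    self_mem_nhdsWithin] with s hs has
  rw [slope_def_field, div_lt_iff₀ (sub_pos.2 has), zero_mul, sub_neg] at hs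
  exact lt_of_pow_lt_pow_left₀ 2 (norm_nonneg _) hs

end NormedSpace

section HamiltonField

variable {F : Type*} [NormedAddCommGroup F] [InnerProductSpace ℝ F] [CompleteSpace F]

/-- The Hamilton vector field `(∂H/∂ζ, -∂H/∂z)` of `H(z, ζ)` on the phase space `F × F`, where
covectors are identified with vectors through the inner product. -/
noncomputable def hamiltonField (H : F → F → ℝ) (p : F × F) : F × F :=
  (gradient (H p.1) p.2, -gradient (fun x ↦ H x p.2) p.1)

theorem isHamiltonCurveOn_iff {n : ℕ} {H : E n → E n → ℝ} {I : Set ℝ} {z ζ : ℝ → E n} :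
    IsHamiltonCurveOn H I z ζ ↔
      IsIntegralCurveOn (fun s ↦ (z s, ζ s)) (fun _ ↦ hamiltonField H) I :=
  forall₂_congr fun _ _ ↦ ⟨fun h ↦ h.1.prodMk h.2, fun h ↦ ⟨h.fst, h.snd⟩⟩

theorem hamiltonField_div_const (H : F → F → ℝ) (c : ℝ) :
    hamiltonField (fun x w ↦ H x w / c) = c⁻¹ • hamiltonField H := by
  have gradient_div_const (f : F → ℝ) (x : F) :
      gradient (fun w ↦ f w / c) x = c⁻¹ • gradient f x := by
    have hf : (fun w ↦ f w / c) = c⁻¹ • f := funext fun w ↦ div_eq_inv_mul _ _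
    rw [hf, gradient, fderiv_const_smul_field, Pi.smul_apply, map_smulₛₗ]
    rfl
  ext1 p
  simp only [hamiltonField, gradient_div_const, Pi.smul_apply, Prod.smul_mk, smul_neg]

variable {H : F → F → ℝ} {p : F × F}

theorem gradient_right_eq (hH : DifferentiableAt ℝ (Function.uncurry H) p) :
    gradient (H p.1) p.2 =
      (InnerProductSpace.toDual ℝ F).symm (fderiv ℝ (Function.uncurry H) p ∘L .inr ℝ F F) := by
  have hpartial : HasFDerivAt (H p.1) (fderiv ℝ (Function.uncurry H) p ∘L .inr ℝ F F) p.2 :=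
    HasFDerivAt.comp (f := (p.1, ·)) p.2 hH.hasFDerivAt (hasFDerivAt_prodMk_right p.1 p.2)
  exact hpartial.hasGradientAt.gradient

theorem gradient_left_eq (hH : DifferentiableAt ℝ (Function.uncurry H) p) :
    gradient (fun x ↦ H x p.2) p.1 =
      (InnerProductSpace.toDual ℝ F).symm (fderiv ℝ (Function.uncurry H) p ∘L .inl ℝ F F) := by
  have hpartial : HasFDerivAt (H · p.2) (fderiv ℝ (Function.uncurry H) p ∘L .inl ℝ F F) p.1 :=
    HasFDerivAt.comp (f := (·, p.2)) p.1 hH.hasFDerivAt (hasFDerivAt_prodMk_left p.1 p.2)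
  exact hpartial.hasGradientAt.gradient

theorem contDiff_hamiltonField {k m : WithTop ℕ∞} (hH : ContDiff ℝ m (Function.uncurry H))
    (hm : k + 1 ≤ m) : ContDiff ℝ k (hamiltonField H) := by
  have hdiff : Differentiable ℝ (Function.uncurry H) :=
    hH.differentiable (one_ne_zero.bot_lt.trans_le (le_add_self.trans hm)).ne'
  have hfderiv : ContDiff ℝ k (fderiv ℝ (Function.uncurry H)) := hH.fderiv_right hm
  have hfield : hamiltonField H = fun p ↦
      ((InnerProductSpace.toDual ℝ F).symm (fderiv ℝ (Function.uncurry H) p ∘L .inr ℝ F F),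
        -(InnerProductSpace.toDual ℝ F).symm (fderiv ℝ (Function.uncurry H) p ∘L .inl ℝ F F)) :=
    funext fun p ↦ by rw [hamiltonField, gradient_right_eq (hdiff p), gradient_left_eq (hdiff p)]
  rw [hfield]
  have htoDual := (InnerProductSpace.toDual ℝ F).symm.contDiff (n := k)
  exact (htoDual.comp (hfderiv.clm_comp contDiff_const)).prodMk
    (htoDual.comp (hfderiv.clm_comp contDiff_const)).neg

theorem fderiv_hamiltonField_eq_zero (hH : DifferentiableAt ℝ (Function.uncurry H) p) :
    fderiv ℝ (Function.uncurry H) p (hamiltonField H p) = 0 := by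
  have hsnd (v : F) : fderiv ℝ (Function.uncurry H) p (0, v) =
      inner ℝ (gradient (H p.1) p.2) v := by
    simp [gradient_right_eq hH]
  have hfst (v : F) : fderiv ℝ (Function.uncurry H) p (v, 0) =
      inner ℝ (gradient (fun x ↦ H x p.2) p.1) v := by
    simp [gradient_left_eq hH]
  rw [hamiltonField, ← Prod.fst_add_snd (_, _), map_add, hfst, hsnd, inner_neg_right,
    real_inner_comm, add_neg_cancel]

theorem hamiltonian_eq_of_isIntegralCurve_smul (hH : Differentiable ℝ (Function.uncurry H))
    {χ : F × F → ℝ} {γ : ℝ → F × F}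
    (hγ : IsIntegralCurve γ (fun _ p ↦ χ p • hamiltonField H p)) (s s' : ℝ) :
    H (γ s).1 (γ s).2 = H (γ s').1 (γ s').2 := by
  have hderiv (s : ℝ) : HasDerivAt (Function.uncurry H ∘ γ) 0 s := by
    have := (hH (γ s)).hasFDerivAt.comp_hasDerivAt s (hγ s)
    rwa [map_smul, fderiv_hamiltonField_eq_zero (hH _), smul_zero] at this
  exact is_const_of_deriv_eq_zero (fun s ↦ (hderiv s).differentiableAt) (fun s ↦ (hderiv s).deriv)
    s s'

end HamiltonField

section Matrix

variable {𝕜 W m : Type*} [NontriviallyNormedField 𝕜] [NormedAddCommGroup W] [NormedSpace 𝕜 W]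
  [Fintype m] [DecidableEq m] {k : WithTop ℕ∞} {A : W → Matrix m m 𝕜}

theorem contDiff_matrix_det (hA : ∀ i j, ContDiff 𝕜 k fun w ↦ A w i j) :
    ContDiff 𝕜 k fun w ↦ (A w).det := by
  simp only [Matrix.det_apply]
  exact ContDiff.sum fun σ _ ↦ (contDiff_prod fun i _ ↦ hA _ _).const_smul _

theorem contDiff_matrix_inv_apply (hA : ∀ i j, ContDiff 𝕜 k fun w ↦ A w i j)
    (hdet : ∀ w, (A w).det ≠ 0) (i j : m) : ContDiff 𝕜 k fun w ↦ (A w)⁻¹ i j := by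
  simp only [Matrix.inv_def, Ring.inverse_eq_inv', Matrix.smul_apply, smul_eq_mul,
    Matrix.adjugate_apply]
  refine ((contDiff_matrix_det hA).inv hdet).mul (contDiff_matrix_det fun a b ↦ ?_)
  rcases eq_or_ne a j with rfl | ha
  · simpa only [Matrix.updateRow_self] using contDiff_const
  · simpa only [Matrix.updateRow_ne ha] using hA a b

end Matrix

namespace MetricFamily

section Cometric

variable {n : ℕ} (g : MetricFamily n) (t : ℝ)

theorem contDiff_cometric : ContDiff ℝ ∞ (Function.uncurry (g.cometric t)) := by
  have hinv (i j : Fin n) : ContDiff ℝ ∞ fun z ↦ (g.coeff t z)⁻¹ i j :=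
    contDiff_matrix_inv_apply (fun i j ↦ (g.smooth i j).comp (contDiff_const.prodMk contDiff_id))
      (fun z ↦ (g.posDef t z).det_pos.ne') i j
  have hsnd (i : Fin n) : ContDiff ℝ ∞ fun p : E n × E n ↦ p.2 i :=
    contDiff_euclidean.1 contDiff_snd i
  unfold Function.uncurry cometric
  exact ContDiff.sum fun i _ ↦ ContDiff.sum fun j _ ↦
    (((hinv i j).comp contDiff_fst).mul (hsnd i)).mul (hsnd j)

theorem contDiff_half_cometric :
    ContDiff ℝ ∞ (Function.uncurry fun x w ↦ g.cometric t x w / 2) :=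
  (g.contDiff_cometric t).div_const 2

theorem cometric_smul (c : ℝ) (z ζ : E n) :
    g.cometric t z (c • ζ) = c ^ 2 * g.cometric t z ζ := by
  simp only [cometric, PiLp.smul_apply, smul_eq_mul, Finset.mul_sum]
  exact Finset.sum_congr rfl fun i _ ↦ Finset.sum_congr rfl fun j _ ↦ by ring

theorem cometric_pos (z : E n) {ζ : E n} (hζ : ζ ≠ 0) : 0 < g.cometric t z ζ := by
  have hquad : ζ.ofLp ⬝ᵥ (g.coeff t z)⁻¹.mulVec ζ.ofLp = g.cometric t z ζ := by
    simp only [cometric, dotProduct, Matrix.mulVec, Finset.mul_sum]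
    exact Finset.sum_congr rfl fun i _ ↦ Finset.sum_congr rfl fun j _ ↦ by ring
  simpa [hquad] using (g.posDef t z).inv.dotProduct_mulVec_pos (x := ζ.ofLp) (by simpa using hζ)

/-- The generator of the unit speed geodesic flow of `g(t)`, lifted to the cotangent bundle. -/
noncomputable def geodesicField : E n × E n → E n × E n :=
  hamiltonField fun x w ↦ g.cometric t x w / 2

theorem contDiff_geodesicField : ContDiff ℝ ∞ (g.geodesicField t) :=
  contDiff_hamiltonField (g.contDiff_half_cometric t) (by simp)

theorem locallyLipschitz_geodesicField : LocallyLipschitz (g.geodesicField t) :=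
  ((g.contDiff_geodesicField t).of_le (by simp)).locallyLipschitz

theorem hamiltonField_cometric : hamiltonField (g.cometric t) = (2 : ℝ) • g.geodesicField t := by
  rw [geodesicField, hamiltonField_div_const, smul_inv_smul₀ two_ne_zero]

end Cometric

section FlatOutsideBall

variable {n : ℕ} {g : MetricFamily n} {t R : ℝ}

/-- `g(t)` is the flat metric outside the open ball `B_R(0)`: the part of
`MetricFamily.IsFlatOutside` that concerns a single time slice. -/
def IsFlatOutsideBall (g : MetricFamily n) (t R : ℝ) : Prop :=
  ∀ z, R ≤ ‖z‖ → g.coeff t z = 1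

theorem IsFlatOutsideBall.cometric_eq (h : g.IsFlatOutsideBall t R) {z : E n} (hz : R ≤ ‖z‖)
    (ζ : E n) : g.cometric t z ζ = ‖ζ‖ ^ 2 := by
  rw [EuclideanSpace.norm_sq_eq]
  simp [cometric, h z hz, Matrix.one_apply, sq]

theorem IsFlatOutsideBall.cometric_eq_one_iff (h : g.IsFlatOutsideBall t R) {z : E n}
    (hz : R ≤ ‖z‖) {ζ : E n} : g.cometric t z ζ = 1 ↔ ‖ζ‖ = 1 := by
  rw [h.cometric_eq hz, pow_eq_one_iff_of_nonneg (norm_nonneg _) two_ne_zero]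

theorem IsFlatOutsideBall.geodesicField_eq (h : g.IsFlatOutsideBall t R) {p : E n × E n}
    (hp : R ≤ ‖p.1‖) : g.geodesicField t p = (p.2, 0) := by
  have hinterior : EqOn (fun x ↦ g.geodesicField t (x, p.2)) (fun _ ↦ (p.2, 0))
      (interior (Metric.ball 0 R)ᶜ) := fun x hx ↦ by
    have hflat {x : E n} (hx : x ∈ interior (Metric.ball 0 R)ᶜ) (w : E n) :
        g.cometric t x w / 2 = ‖w‖ ^ 2 / 2 := by
      rw [h.cometric_eq (by simpa using interior_subset hx)]
    have hfst : (fun x ↦ g.cometric t x p.2 / 2) =ᶠ[𝓝 x] fun _ ↦ ‖p.2‖ ^ 2 / 2 := by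
      filter_upwards [isOpen_interior.mem_nhds hx] with y hy using hflat hy _
    have hsnd : HasGradientAt (fun w : E n ↦ ‖w‖ ^ 2 / 2) p.2 p.2 := by
      rw [hasGradientAt_iff_hasFDerivAt]
      refine ((hasStrictFDerivAt_norm_sq p.2).hasFDerivAt.mul_const (2⁻¹ : ℝ)).congr_fderiv ?_
      ext v
      simp
    simp only [geodesicField, hamiltonField, funext (hflat hx), hsnd.gradient, hfst.gradient_eq,
      gradient_fun_const, neg_zero]
  have hcont : Continuous fun x ↦ g.geodesicField t (x, p.2) :=
    (g.contDiff_geodesicField t).continuous.comp (by fun_prop)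
  exact hinterior.closure hcont continuous_const
    (compl_ball_subset_closure_interior_compl_ball 0 R (by simpa using hp))

theorem IsFlatOutsideBall.exists_norm_le (h : g.IsFlatOutsideBall t R) :
    ∃ M : ℝ, ∀ z ζ : E n, g.cometric t z ζ = 1 → ‖ζ‖ ≤ M := by
  have hcont : ContinuousOn (fun p : E n × E n ↦ (g.cometric t p.1 p.2)⁻¹)
      (Metric.closedBall 0 R ×ˢ Metric.sphere 0 1) :=
    (g.contDiff_cometric t).continuous.continuousOn.inv₀ fun p hp ↦
      (g.cometric_pos t p.1 (ne_zero_of_mem_unit_sphere ⟨p.2, hp.2⟩)).ne'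
  obtain ⟨C, hC⟩ := ((isCompact_closedBall _ _).prod
    (isCompact_sphere _ _)).exists_bound_of_continuousOn hcont
  refine ⟨max 1 (C + 1), fun z ζ hζ ↦ ?_⟩
  rcases le_total R ‖z‖ with hz | hz
  · exact ((h.cometric_eq_one_iff hz).1 hζ).trans_le (le_max_left _ _)
  · refine le_max_of_le_right ?_
    have hζ₀ : ζ ≠ 0 := by
      rintro rfl
      simp [cometric] at hζ
    have hnormalized : ‖ζ‖ ^ 2 ≤ C := by
      simpa [cometric_smul, hζ] using
        hC (z, ‖ζ‖⁻¹ • ζ) ⟨by simpa using hz, by simp [norm_smul, hζ₀]⟩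
    nlinarith [sq_nonneg (‖ζ‖ - 1)]

theorem IsFlatOutsideBall.exists_lipschitzWith_smul_geodesicField (h : g.IsFlatOutsideBall t R)
    {χ : E n → ℝ} (hχ : ContDiff ℝ 1 χ) (hsupp : HasCompactSupport χ) :
    ∃ K, LipschitzWith K fun p ↦ χ p.2 • g.geodesicField t p := by
  have hX : ContDiff ℝ 1 (g.geodesicField t) := (g.contDiff_geodesicField t).of_le (by simp)
  have hfree : ContDiff ℝ 1 fun w : E n ↦ χ w • (w, (0 : E n)) :=
    hχ.smul (contDiff_id.prodMk contDiff_const)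
  have hdiff : ContDiff ℝ 1 fun p : E n × E n ↦ χ p.2 • (g.geodesicField t p - (p.2, 0)) :=
    (hχ.comp contDiff_snd).smul (hX.sub (contDiff_snd.prodMk contDiff_const))
  have hdiff_supp : HasCompactSupport fun p : E n × E n ↦
      χ p.2 • (g.geodesicField t p - (p.2, 0)) := by
    refine .intro ((isCompact_closedBall 0 R).prod hsupp.isCompact) fun p hp ↦ ?_
    rcases le_total R ‖p.1‖ with hz | hz
    · rw [h.geodesicField_eq hz, sub_self, smul_zero]
    · have hp₂ : p.2 ∉ tsupport χ := fun hmem ↦ hp ⟨by simpa using hz, hmem⟩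
      rw [image_eq_zero_of_notMem_tsupport hp₂, zero_smul]
  obtain ⟨K₁, hK₁⟩ := hfree.lipschitzWith_of_hasCompactSupport hsupp.smul_right one_ne_zero
  obtain ⟨K₂, hK₂⟩ := hdiff.lipschitzWith_of_hasCompactSupport hdiff_supp one_ne_zero
  have hsplit : (fun p ↦ χ p.2 • g.geodesicField t p) = fun p : E n × E n ↦
      χ p.2 • (p.2, (0 : E n)) + χ p.2 • (g.geodesicField t p - (p.2, 0)) :=
    funext fun p ↦ by rw [← smul_add, add_sub_cancel]
  exact ⟨_, hsplit ▸ (hK₁.comp LipschitzWith.prod_snd).add hK₂⟩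

-- Unit covectors are bounded and the Hamiltonian is conserved, so cutting the geodesic field off at
-- large covectors makes it globally Lipschitz without changing its unit speed integral curves.
theorem IsFlatOutsideBall.exists_isLiftedGeodesicOn_univ (h : g.IsFlatOutsideBall t R)
    {z₀ ζ₀ : E n} (h₀ : g.cometric t z₀ ζ₀ = 1) :
    ∃ z ζ : ℝ → E n, (z 0, ζ 0) = (z₀, ζ₀) ∧ g.IsLiftedGeodesicOn t univ z ζ := by
  obtain ⟨M, hM⟩ := h.exists_norm_le
  let χ : ContDiffBump (0 : E n) := ⟨max M 0 + 1, max M 0 + 2, by positivity, by linarith⟩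
  obtain ⟨K, hK⟩ := h.exists_lipschitzWith_smul_geodesicField χ.contDiff χ.hasCompactSupport
  obtain ⟨γ, hγ₀, hγ⟩ := exists_isIntegralCurve_of_contDiff_of_lipschitzWith
    ((χ.contDiff.comp contDiff_snd).smul ((g.contDiff_geodesicField t).of_le (by simp))) hK
    (z₀, ζ₀)
  have hunit (s : ℝ) : g.cometric t (γ s).1 (γ s).2 = 1 := by
    have hconst := hamiltonian_eq_of_isIntegralCurve_smul
      ((g.contDiff_half_cometric t).differentiable (by simp)) hγ s 0
    rwa [hγ₀, h₀, div_left_inj' two_ne_zero] at hconst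
  have hcutoff (s : ℝ) : χ (γ s).2 = 1 := χ.one_of_mem_closedBall <|
    mem_closedBall_zero_iff.2 <| (hM _ _ (hunit s)).trans <|
      (le_max_left M 0).trans (le_add_of_nonneg_right zero_le_one)
  refine ⟨fun s ↦ (γ s).1, fun s ↦ (γ s).2, hγ₀, isHamiltonCurveOn_iff.2 ?_, fun s _ ↦ hunit s⟩
  refine isIntegralCurveOn_univ.2 fun s ↦ ?_
  have hderiv : HasDerivAt γ (χ (γ s).2 • g.geodesicField t (γ s)) s := hγ s
  rwa [hcutoff, one_smul] at hderiv

end FlatOutsideBall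

end MetricFamily

section Lines

variable {F : Type*} [NormedAddCommGroup F] [InnerProductSpace ℝ F] {z v : F}

theorem norm_le_norm_add_smul {s : ℝ} (h : 0 ≤ s * inner ℝ z v) : ‖z‖ ≤ ‖z + s • v‖ := by
  refine le_of_sq_le_sq ?_ (norm_nonneg _)
  rw [norm_add_sq_real, inner_smul_right]
  linarith [sq_nonneg ‖s • v‖]

theorem norm_add_smul_sq_of_norm_eq_one (hv : ‖v‖ = 1) (s : ℝ) :
    ‖z + s • v‖ ^ 2 = ‖z‖ ^ 2 + 2 * s * inner ℝ z v + s ^ 2 := by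
  rw [norm_add_sq_real, inner_smul_right, norm_smul, hv, Real.norm_eq_abs, mul_one, sq_abs]
  ring

theorem norm_sub_inner_smul_sq (hv : ‖v‖ = 1) (z : F) :
    ‖z - inner ℝ z v • v‖ ^ 2 = ‖z‖ ^ 2 - inner ℝ z v ^ 2 := by
  rw [sub_eq_add_neg, ← neg_smul, norm_add_smul_sq_of_norm_eq_one hv]
  ring

theorem tendsto_norm_add_smul_atTop (hv : v ≠ 0) (z : F) :
    Tendsto (fun s : ℝ ↦ ‖z + s • v‖) atTop atTop := by
  have hsmul : Tendsto (fun s : ℝ ↦ s * ‖v‖) atTop atTop :=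
    tendsto_id.atTop_mul_const (norm_pos_iff.2 hv)
  refine tendsto_atTop_mono (fun s ↦ ?_) (tendsto_atTop_add_const_right atTop (-‖z‖) hsmul)
  calc s * ‖v‖ + -‖z‖ ≤ ‖s • v‖ - ‖-z‖ := by
        rw [norm_smul, norm_neg, ← sub_eq_add_neg]
        gcongr
        exact Real.le_norm_self s
    _ ≤ ‖z + s • v‖ := by simpa [add_comm] using norm_sub_norm_le (s • v) (-z)

theorem tendsto_norm_add_smul_sub_atTop (hv : ‖v‖ = 1) (z : F) :
    Tendsto (fun s : ℝ ↦ ‖z + s • v‖ - s) atTop (𝓝 (inner ℝ z v)) := by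
  set a : ℝ := inner ℝ z v
  have hden : Tendsto (fun s : ℝ ↦ ‖z + s • v‖ + (s + a)) atTop atTop :=
    (tendsto_norm_add_smul_atTop (norm_ne_zero_iff.1 (hv ▸ one_ne_zero)) z).atTop_add_atTop
      (tendsto_atTop_add_const_right _ a tendsto_id)
  have hlim : Tendsto (fun s : ℝ ↦ (‖z‖ ^ 2 - a ^ 2) / (‖z + s • v‖ + (s + a)) + a) atTop
      (𝓝 a) := by
    simpa using (hden.const_div_atTop (‖z‖ ^ 2 - a ^ 2)).add_const a
  refine hlim.congr' ?_
  filter_upwards [hden.eventually_gt_atTop 0] with s hs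
  field_simp
  linear_combination -norm_add_smul_sq_of_norm_eq_one (z := z) hv s

theorem tendsto_line_sub_norm_smul_atTop (hv : ‖v‖ = 1) (z : F) :
    Tendsto (fun s : ℝ ↦ z + s • v - ‖z + s • v‖ • v) atTop (𝓝 (z - inner ℝ z v • v)) := by
  refine (((tendsto_norm_add_smul_sub_atTop hv z).smul_const v).const_sub z).congr fun s ↦ ?_
  module

theorem tendsto_line_add_norm_smul_atBot (hv : ‖v‖ = 1) (z : F) :
    Tendsto (fun s : ℝ ↦ z + s • v + ‖z + s • v‖ • v) atBot (𝓝 (z - inner ℝ z v • v)) := by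
  simpa [Function.comp_def] using
    (tendsto_line_sub_norm_smul_atTop ((norm_neg v).trans hv) z).comp tendsto_neg_atBot_atTop

theorem isIntegralCurve_line (c v : F) (s₀ : ℝ) :
    IsIntegralCurve (fun s ↦ (c + (s - s₀) • v, v)) (fun _ p ↦ (p.2, (0 : F))) := fun s ↦ by
  have hline : HasDerivAt (fun s : ℝ ↦ c + (s - s₀) • v) v s := by
    simpa using (((hasDerivAt_id s).sub_const s₀).smul_const v).const_add c
  exact hline.prodMk (hasDerivAt_const s v)

end Lines

section EndpointsAtInfinity

variable {n : ℕ} {t T R : ℝ} {z ζ z' ζ' : ℝ → E n} {q q' : OneCuspBoundary n}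

/-- The endpoint at infinity, in either direction, of the line `z + ℝ v` with covector `v` in the
time slice `t`; its `η` is the negative of the foot of the perpendicular from the origin. -/
noncomputable def lineEndpoint (t : ℝ) (z v : E n) (hv : ‖v‖ = 1) : OneCuspBoundary n where
  y := v
  ξ := -2 * t
  η := -(z - inner ℝ z v • v)
  norm_y := hv
  orth := by
    rw [inner_neg_right, inner_sub_right, inner_smul_right, real_inner_self_eq_norm_sq, hv,
      real_inner_comm, one_pow, mul_one, sub_self, neg_zero]

/-- The backward endpoint at infinity of the line that enters the ball at `p`. -/
noncomputable def incomingEndpoint (p : InwardBoundary n T R) : OneCuspBoundary n :=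
  lineEndpoint p.1.1 p.1.2.1 p.1.2.2 p.2.2.2.1

/-- The forward endpoint at infinity of the line that leaves the ball at `p`. -/
noncomputable def outgoingEndpoint (p : OutwardBoundary n T R) : OneCuspBoundary n :=
  lineEndpoint p.1.1 p.1.2.1 p.1.2.2 p.2.2.2.1

theorem TendsToForward.comp (h : TendsToForward t z ζ q) {φ : ℝ → ℝ} (hφ : Tendsto φ atTop atTop) :
    TendsToForward t (z ∘ φ) (ζ ∘ φ) q :=
  ⟨h.1.comp hφ, h.2.1.comp hφ, h.2.2.1, h.2.2.2.comp hφ⟩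

theorem TendsToBackward.comp (h : TendsToBackward t z ζ q) {φ : ℝ → ℝ}
    (hφ : Tendsto φ atBot atBot) : TendsToBackward t (z ∘ φ) (ζ ∘ φ) q :=
  ⟨h.1.comp hφ, h.2.1.comp hφ, h.2.2.1, h.2.2.2.comp hφ⟩

theorem TendsToForward.congr' (h : TendsToForward t z ζ q)
    (heq : ∀ᶠ s in atTop, (z s, ζ s) = (z' s, ζ' s)) : TendsToForward t z' ζ' q := by
  obtain ⟨hz, hζ⟩ : z =ᶠ[atTop] z' ∧ ζ =ᶠ[atTop] ζ' := by
    simpa only [EventuallyEq, Prod.mk.injEq, eventually_and] using heq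
  exact ⟨h.1.congr' (hz.fun_comp norm), h.2.1.congr' hζ, h.2.2.1,
    h.2.2.2.congr' (hz.sub ((hz.fun_comp norm).smul hζ))⟩

theorem TendsToBackward.congr' (h : TendsToBackward t z ζ q)
    (heq : ∀ᶠ s in atBot, (z s, ζ s) = (z' s, ζ' s)) : TendsToBackward t z' ζ' q := by
  obtain ⟨hz, hζ⟩ : z =ᶠ[atBot] z' ∧ ζ =ᶠ[atBot] ζ' := by
    simpa only [EventuallyEq, Prod.mk.injEq, eventually_and] using heq
  exact ⟨h.1.congr' (hz.fun_comp norm), h.2.1.congr' hζ, h.2.2.1,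
    h.2.2.2.congr' (hz.add ((hz.fun_comp norm).smul hζ))⟩

theorem TendsToForward.unique (h : TendsToForward t z ζ q) (h' : TendsToForward t z ζ q') :
    q = q' := by
  obtain ⟨-, hy, hξ, hη⟩ := h
  obtain ⟨-, hy', hξ', hη'⟩ := h'
  exact OneCuspBoundary.ext (tendsto_nhds_unique hy hy') (hξ.trans hξ'.symm)
    (neg_injective (tendsto_nhds_unique hη hη'))

theorem TendsToBackward.unique (h : TendsToBackward t z ζ q) (h' : TendsToBackward t z ζ q') :
    q = q' := by
  obtain ⟨-, hy, hξ, hη⟩ := h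
  obtain ⟨-, hy', hξ', hη'⟩ := h'
  exact OneCuspBoundary.ext (tendsto_nhds_unique hy hy') (hξ.trans hξ'.symm)
    (neg_injective (tendsto_nhds_unique hη hη'))

theorem tendsToForward_line (t s₀ : ℝ) (c : E n) {v : E n} (hv : ‖v‖ = 1) :
    TendsToForward t (fun s ↦ c + (s - s₀) • v) (fun _ ↦ v) (lineEndpoint t c v hv) := by
  have hline : TendsToForward t (fun s ↦ c + s • v) (fun _ ↦ v) (lineEndpoint t c v hv) :=
    ⟨tendsto_norm_add_smul_atTop (norm_ne_zero_iff.1 (hv ▸ one_ne_zero)) c, tendsto_const_nhds, rfl,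
      by simpa only [lineEndpoint, neg_neg] using tendsto_line_sub_norm_smul_atTop hv c⟩
  exact hline.comp (tendsto_atTop_add_const_right atTop (-s₀) tendsto_id)

theorem tendsToBackward_line (t s₀ : ℝ) (c : E n) {v : E n} (hv : ‖v‖ = 1) :
    TendsToBackward t (fun s ↦ c + (s - s₀) • v) (fun _ ↦ v) (lineEndpoint t c v hv) := by
  have hnorm : Tendsto (fun s : ℝ ↦ ‖c + s • v‖) atBot atTop := by
    simpa [Function.comp_def] using (tendsto_norm_add_smul_atTop (v := -v)
      (neg_ne_zero.2 (norm_ne_zero_iff.1 (hv ▸ one_ne_zero))) c).comp tendsto_neg_atBot_atTop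
  have hline : TendsToBackward t (fun s ↦ c + s • v) (fun _ ↦ v) (lineEndpoint t c v hv) :=
    ⟨hnorm, tendsto_const_nhds, rfl,
      by simpa only [lineEndpoint, neg_neg] using tendsto_line_add_norm_smul_atBot hv c⟩
  exact hline.comp (tendsto_atBot_add_const_right atBot (-s₀) tendsto_id)

theorem outgoingEndpoint_injective :
    Function.Injective (outgoingEndpoint : OutwardBoundary n T R → OneCuspBoundary n) := by
  rintro ⟨⟨t, z, v⟩, ht, hz, hv, hpos⟩ ⟨⟨t', z', v'⟩, ht', hz', hv', hpos'⟩ heq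
  obtain rfl : t = t' := mul_left_cancel₀ (by norm_num) (congrArg OneCuspBoundary.ξ heq)
  obtain rfl : v = v' := congrArg OneCuspBoundary.y heq
  have hfoot : z - inner ℝ z v • v = z' - inner ℝ z' v • v :=
    neg_injective (congrArg OneCuspBoundary.η heq)
  have hsq : inner ℝ z v ^ 2 = inner ℝ z' v ^ 2 := by
    have hpyth := norm_sub_inner_smul_sq hv z
    rw [hfoot, norm_sub_inner_smul_sq hv, show ‖z'‖ = ‖z‖ from hz'.trans hz.symm] at hpyth
    linarith
  rw [(pow_left_inj₀ hpos.le hpos'.le two_ne_zero).1 hsq, sub_left_inj] at hfoot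
  subst hfoot
  rfl

end EndpointsAtInfinity

namespace MetricFamily

variable {n : ℕ} {g : MetricFamily n} {t T R : ℝ}

section Geodesics

variable {I : Set ℝ} {z ζ z' ζ' : ℝ → E n} {s₀ ℓ : ℝ}

theorem IsLiftedGeodesicOn.isIntegralCurveOn (h : g.IsLiftedGeodesicOn t I z ζ) :
    IsIntegralCurveOn (fun s ↦ (z s, ζ s)) (fun _ ↦ g.geodesicField t) I :=
  isHamiltonCurveOn_iff.1 h.1

theorem IsLiftedGeodesicOn.mono (h : g.IsLiftedGeodesicOn t I z ζ) {J : Set ℝ} (hJ : J ⊆ I) :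
    g.IsLiftedGeodesicOn t J z ζ :=
  ⟨isHamiltonCurveOn_iff.2 (h.isIntegralCurveOn.mono hJ), fun s hs ↦ h.2 s (hJ hs)⟩

theorem IsLiftedGeodesicOn.comp_add (h : g.IsLiftedGeodesicOn t univ z ζ) (σ : ℝ) :
    g.IsLiftedGeodesicOn t univ (z ∘ (· + σ)) (ζ ∘ (· + σ)) :=
  ⟨isHamiltonCurveOn_iff.2 <| isIntegralCurveOn_univ.2 <|
    (isIntegralCurveOn_univ.1 h.isIntegralCurveOn).comp_add σ, fun _ _ ↦ h.2 _ trivial⟩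

theorem IsLiftedGeodesicOn.eqOn [I.OrdConnected] (h : g.IsLiftedGeodesicOn t I z ζ)
    (h' : g.IsLiftedGeodesicOn t I z' ζ') (hs₀ : s₀ ∈ I)
    (h₀ : (z s₀, ζ s₀) = (z' s₀, ζ' s₀)) : ∀ s ∈ I, (z s, ζ s) = (z' s, ζ' s) :=
  eqOn_of_isIntegralCurveOn_of_locallyLipschitz (g.locallyLipschitz_geodesicField t)
    h.isIntegralCurveOn h'.isIntegralCurveOn hs₀ h₀

theorem IsFlatOutsideBall.isLiftedGeodesicOn_line (hflat : g.IsFlatOutsideBall t R) {c v : E n}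
    (hv : ‖v‖ = 1) (hout : ∀ s ∈ I, R ≤ ‖c + (s - s₀) • v‖) :
    g.IsLiftedGeodesicOn t I (fun s ↦ c + (s - s₀) • v) (fun _ ↦ v) := by
  refine ⟨isHamiltonCurveOn_iff.2 fun s hs ↦ ?_,
    fun s hs ↦ (hflat.cometric_eq_one_iff (hout s hs)).2 hv⟩
  have hline : HasDerivWithinAt (fun s ↦ (c + (s - s₀) • v, v)) (v, (0 : E n)) I s :=
    (isIntegralCurve_line c v s₀).isIntegralCurveOn I s hs
  rwa [← hflat.geodesicField_eq (p := (c + (s - s₀) • v, v)) (hout s hs)] at hline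

theorem IsLiftedGeodesicOn.eq_line_of_le_norm [I.OrdConnected] (h : g.IsLiftedGeodesicOn t I z ζ)
    (hflat : g.IsFlatOutsideBall t R) (hout : ∀ s ∈ I, R ≤ ‖z s‖) (hs₀ : s₀ ∈ I) :
    ∀ s ∈ I, (z s, ζ s) = (z s₀ + (s - s₀) • ζ s₀, ζ s₀) := by
  have hfree : IsIntegralCurveOn (fun s ↦ (z s, ζ s)) (fun _ p ↦ (p.2, (0 : E n))) I :=
    fun s hs ↦ by
      have hgeod : HasDerivWithinAt (fun s ↦ (z s, ζ s)) (g.geodesicField t (z s, ζ s)) I s :=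
        h.isIntegralCurveOn s hs
      rwa [hflat.geodesicField_eq (p := (z s, ζ s)) (hout s hs)] at hgeod
  exact eqOn_of_isIntegralCurveOn_of_locallyLipschitz
    (ContDiff.locallyLipschitz (𝕂 := ℝ) (contDiff_snd.prodMk contDiff_const)) hfree
    ((isIntegralCurve_line (z s₀) (ζ s₀) s₀).isIntegralCurveOn I) hs₀ (by simp)

theorem IsLiftedGeodesicOn.eq_line_of_nonneg_mul_inner [I.OrdConnected]
    (h : g.IsLiftedGeodesicOn t I z ζ) (hflat : g.IsFlatOutsideBall t R) (hs₀ : s₀ ∈ I)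
    (hR : R ≤ ‖z s₀‖) (hdir : ∀ s ∈ I, 0 ≤ (s - s₀) * inner ℝ (z s₀) (ζ s₀)) :
    ∀ s ∈ I, (z s, ζ s) = (z s₀ + (s - s₀) • ζ s₀, ζ s₀) :=
  h.eqOn (hflat.isLiftedGeodesicOn_line ((hflat.cometric_eq_one_iff hR).1 (h.2 s₀ hs₀))
    fun s hs ↦ hR.trans (norm_le_norm_add_smul (hdir s hs))) hs₀ (by simp)

theorem IsLiftedGeodesicOn.inner_pos_of_norm_lt (h : g.IsLiftedGeodesicOn t (Icc s₀ ℓ) z ζ)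
    (hflat : g.IsFlatOutsideBall t R) (hs₀ : s₀ ≤ ℓ) (hin : ‖z s₀‖ < R) (hout : R ≤ ‖z ℓ‖) :
    0 < inner ℝ (z ℓ) (ζ ℓ) := by
  by_contra! hle
  have hdir (s : ℝ) (hs : s ∈ Icc s₀ ℓ) : 0 ≤ (s - ℓ) * inner ℝ (z ℓ) (ζ ℓ) :=
    mul_nonneg_of_nonpos_of_nonpos (sub_nonpos.2 hs.2) hle
  have hline : z s₀ = z ℓ + (s₀ - ℓ) • ζ ℓ := congrArg Prod.fst <|
    h.eq_line_of_nonneg_mul_inner hflat (right_mem_Icc.2 hs₀) hout hdir s₀ (left_mem_Icc.2 hs₀)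
  rw [hline] at hin
  exact hin.not_ge (hout.trans (norm_le_norm_add_smul (hdir s₀ (left_mem_Icc.2 hs₀))))

end Geodesics

section Scattering

variable {z ζ : ℝ → E n} {ℓ : ℝ} {p : InwardBoundary n T R} {p' : OutwardBoundary n T R}
  {q q' : OneCuspBoundary n}

theorem isBicharacteristicAtFibreInfinity_comp_mul_two :
    g.IsBicharacteristicAtFibreInfinity t (z ∘ (· * 2)) (ζ ∘ (· * 2)) ↔
      g.IsLiftedGeodesicOn t univ z ζ := by
  refine and_congr ?_ ?_
  · simp only [isHamiltonCurveOn_iff, isIntegralCurveOn_univ, hamiltonField_cometric]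
    exact (isIntegralCurve_comp_mul_ne_zero (γ := fun s ↦ (z s, ζ s))
      (v := fun _ ↦ g.geodesicField t) two_ne_zero)
  · simp only [mem_univ, true_implies]
    exact (mul_right_surjective₀ (two_ne_zero' ℝ)).forall
      (p := fun s ↦ g.cometric t (z s) (ζ s) = 1) |>.symm

theorem classicalScattering_iff : g.ClassicalScattering q q' ↔
    ∃ (t : ℝ) (z ζ : ℝ → E n), g.IsLiftedGeodesicOn t univ z ζ ∧
      TendsToBackward t z ζ q ∧ TendsToForward t z ζ q' := by
  constructor
  · rintro ⟨t, z, ζ, h, hb, hf⟩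
    refine ⟨t, z ∘ (· * 2⁻¹), ζ ∘ (· * 2⁻¹), isBicharacteristicAtFibreInfinity_comp_mul_two.1 ?_,
      hb.comp (tendsto_id.atBot_mul_const (by positivity)),
      hf.comp (tendsto_id.atTop_mul_const (by positivity))⟩
    simpa [Function.comp_def] using h
  · rintro ⟨t, z, ζ, h, hb, hf⟩
    exact ⟨t, _, _, isBicharacteristicAtFibreInfinity_comp_mul_two.2 h,
      hb.comp (tendsto_id.atBot_mul_const two_pos), hf.comp (tendsto_id.atTop_mul_const two_pos)⟩

theorem IsFlatOutsideBall.tendsToForward_outgoingEndpoint (hflat : g.IsFlatOutsideBall p'.1.1 R)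
    (h : g.IsLiftedGeodesicOn p'.1.1 (Ici ℓ) z ζ) (hℓ : (z ℓ, ζ ℓ) = p'.1.2) :
    TendsToForward p'.1.1 z ζ (outgoingEndpoint p') := by
  obtain ⟨⟨t, c, v⟩, ht, hc, hv, hpos⟩ := p'
  obtain ⟨rfl, rfl⟩ := Prod.mk.inj hℓ
  refine (tendsToForward_line t ℓ (z ℓ) hv).congr' ?_
  filter_upwards [eventually_ge_atTop ℓ] with s hs
  exact (h.eq_line_of_nonneg_mul_inner hflat self_mem_Ici hc.ge
    (fun u hu ↦ mul_nonneg (sub_nonneg.2 hu) hpos.le) s hs).symm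

theorem IsFlatOutsideBall.tendsToBackward_incomingEndpoint (hflat : g.IsFlatOutsideBall p.1.1 R)
    (h : g.IsLiftedGeodesicOn p.1.1 (Iic ℓ) z ζ) (hℓ : (z ℓ, ζ ℓ) = p.1.2) :
    TendsToBackward p.1.1 z ζ (incomingEndpoint p) := by
  obtain ⟨⟨t, c, v⟩, ht, hc, hv, hneg⟩ := p
  obtain ⟨rfl, rfl⟩ := Prod.mk.inj hℓ
  refine (tendsToBackward_line t ℓ (z ℓ) hv).congr' ?_
  filter_upwards [eventually_le_atBot ℓ] with s hs
  exact (h.eq_line_of_nonneg_mul_inner hflat self_mem_Iic hc.ge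
    (fun u hu ↦ mul_nonneg_of_nonpos_of_nonpos (sub_nonpos.2 hu) hneg.le) s hs).symm

theorem IsFlatOutsideBall.exists_eq_line_of_tendsToBackward (hflat : g.IsFlatOutsideBall t R)
    (h : g.IsLiftedGeodesicOn t univ z ζ) (hq : TendsToBackward t z ζ q) :
    ∃ (s₀ : ℝ) (c v : E n) (hv : ‖v‖ = 1), lineEndpoint t c v hv = q ∧
      ∀ s ≤ s₀, (z s, ζ s) = (c + (s - s₀) • v, v) := by
  obtain ⟨s₀, hs₀⟩ := eventually_atBot.1 (hq.1.eventually_ge_atTop R)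
  have hline := (h.mono (subset_univ (Iic s₀))).eq_line_of_le_norm hflat hs₀ self_mem_Iic
  have hv : ‖ζ s₀‖ = 1 := (hflat.cometric_eq_one_iff (hs₀ s₀ le_rfl)).1 (h.2 s₀ trivial)
  refine ⟨s₀, z s₀, ζ s₀, hv, ?_, hline⟩
  refine TendsToBackward.unique ((tendsToBackward_line t s₀ (z s₀) hv).congr' ?_) hq
  filter_upwards [eventually_le_atBot s₀] with s hs using (hline s hs).symm

theorem IsFlatOutsideBall.exists_eq_of_tendsToBackward_incomingEndpoint
    (hflat : g.IsFlatOutsideBall p.1.1 R) (h : g.IsLiftedGeodesicOn p.1.1 univ z ζ)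
    (hp : TendsToBackward p.1.1 z ζ (incomingEndpoint p)) : ∃ σ, (z σ, ζ σ) = p.1.2 := by
  obtain ⟨s₀, c, v, hv, hend, hline⟩ := hflat.exists_eq_line_of_tendsToBackward h hp
  obtain ⟨⟨t, c₀, v₀⟩, ht, hc₀, hv₀, hneg⟩ := p
  obtain rfl : v = v₀ := congrArg OneCuspBoundary.y hend
  have hfoot : c - inner ℝ c v • v = c₀ - inner ℝ c₀ v • v :=
    neg_injective (congrArg OneCuspBoundary.η hend)
  let σ := s₀ + (inner ℝ c₀ v - inner ℝ c v)
  have hparam (s : ℝ) : c + (s - s₀) • v = c₀ + (s - σ) • v := by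
    rw [sub_eq_iff_eq_add.1 hfoot]
    module
  have hentering : g.IsLiftedGeodesicOn t (Iic σ) (fun s ↦ c₀ + (s - σ) • v) (fun _ ↦ v) :=
    hflat.isLiftedGeodesicOn_line hv fun s hs ↦ hc₀.symm.trans_le <| norm_le_norm_add_smul <|
      mul_nonneg_of_nonpos_of_nonpos (sub_nonpos.2 hs) hneg.le
  have hagree := (h.mono (subset_univ (Iic σ))).eqOn hentering (min_le_right s₀ σ)
    ((hline _ (min_le_left s₀ σ)).trans (by rw [hparam]))
  exact ⟨σ, by simpa using hagree σ self_mem_Iic⟩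

theorem TruncatedScattering.unique {p'' : OutwardBoundary n T R}
    (h' : g.TruncatedScattering T R p p') (h'' : g.TruncatedScattering T R p p'') : p' = p'' := by
  obtain ⟨ht', ℓ', hℓ', z', ζ', hgeod', h₀', hend', hin'⟩ := h'
  obtain ⟨ht'', ℓ'', hℓ'', z'', ζ'', hgeod'', h₀'', hend'', hin''⟩ := h''
  wlog hle : ℓ' ≤ ℓ'' generalizing p' p'' ℓ' ℓ'' z' z'' ζ' ζ''
  · exact (this ht'' ℓ'' hℓ'' z'' ζ'' hgeod'' h₀'' hend'' hin'' ht' ℓ' hℓ' z' ζ' hgeod' h₀' hend'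
      hin' (le_of_not_ge hle)).symm
  have hagree : (z' ℓ', ζ' ℓ') = (z'' ℓ', ζ'' ℓ') :=
    hgeod'.eqOn (hgeod''.mono (Icc_subset_Icc_right hle)) (left_mem_Icc.2 hℓ'.le)
      (h₀'.trans h₀''.symm) ℓ' (right_mem_Icc.2 hℓ'.le)
  have hsphere : ‖z'' ℓ'‖ = R :=
    (congrArg (‖·.1‖) (hagree.symm.trans hend')).trans p'.2.2.1
  obtain rfl : ℓ' = ℓ'' := hle.eq_of_not_lt fun hlt ↦ (hin'' ℓ' ⟨hℓ', hlt⟩).ne hsphere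
  exact Subtype.ext (Prod.ext (ht'.trans ht''.symm) (hend'.symm.trans (hagree.trans hend'')))

theorem IsFlatOutsideBall.exists_truncatedScattering (hflat : g.IsFlatOutsideBall p.1.1 R)
    (h : g.IsLiftedGeodesicOn p.1.1 univ z ζ) (h₀ : (z 0, ζ 0) = p.1.2)
    (hexit : ∃ s > 0, R ≤ ‖z s‖) :
    ∃ (p' : OutwardBoundary n T R) (ℓ : ℝ), 0 < ℓ ∧ g.TruncatedScattering T R p p' ∧
      (z ℓ, ζ ℓ) = p'.1.2 := by
  obtain ⟨⟨t, c, v⟩, ht, hc, hv, hneg⟩ := p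
  obtain ⟨rfl, rfl⟩ := Prod.mk.inj h₀
  obtain ⟨b, hb, hRb⟩ := hexit
  have hcont : Continuous z :=
    continuous_fst.comp (isIntegralCurveOn_univ.1 h.isIntegralCurveOn).continuous
  have hvelocity : HasDerivWithinAt z (ζ 0) (Ioi 0) 0 := by
    have hderiv : HasDerivWithinAt (fun s ↦ (z s, ζ s)) (g.geodesicField t (z 0, ζ 0)) univ 0 :=
      h.isIntegralCurveOn 0 trivial
    rw [hflat.geodesicField_eq hc.ge] at hderiv
    exact HasDerivWithinAt.mono hderiv.fst (subset_univ _)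
  have henters : ∀ᶠ s in 𝓝[>] 0, ‖z s‖ < R := by
    simpa only [hc] using eventually_norm_lt_of_inner_neg hvelocity hneg
  obtain ⟨ℓ, hℓ, hzℓ, hin⟩ := exists_first_hit hcont.norm henters hb hRb
  have hmid : ‖z (ℓ / 2)‖ < R := hin _ ⟨half_pos hℓ, half_lt_self hℓ⟩
  have hpos : 0 < inner ℝ (z ℓ) (ζ ℓ) :=
    (h.mono (subset_univ _)).inner_pos_of_norm_lt hflat (half_le_self hℓ.le) hmid hzℓ.ge
  have hunit : ‖ζ ℓ‖ = 1 := (hflat.cometric_eq_one_iff hzℓ.ge).1 (h.2 ℓ trivial)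
  exact ⟨⟨(t, z ℓ, ζ ℓ), ht, hzℓ, hunit, hpos⟩, ℓ, hℓ,
    ⟨rfl, ℓ, hℓ, z, ζ, h.mono (subset_univ _), rfl, rfl, hin⟩, rfl⟩

theorem IsFlatOutsideBall.exists_isLiftedGeodesicOn_univ_of_inwardBoundary
    (hflat : g.IsFlatOutsideBall p.1.1 R) :
    ∃ z ζ : ℝ → E n, (z 0, ζ 0) = p.1.2 ∧ g.IsLiftedGeodesicOn p.1.1 univ z ζ :=
  hflat.exists_isLiftedGeodesicOn_univ ((hflat.cometric_eq_one_iff p.2.2.1.ge).2 p.2.2.2.1)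

theorem IsFlatOutsideBall.classicalScattering_of_truncatedScattering
    (hflat : g.IsFlatOutsideBall p.1.1 R) (h : g.TruncatedScattering T R p p') :
    g.ClassicalScattering (incomingEndpoint p) (outgoingEndpoint p') := by
  obtain ⟨ht, ℓ, hℓ, z, ζ, hgeod, h₀, hend, -⟩ := h
  obtain ⟨z', ζ', h₀', hgeod'⟩ :=
    hflat.exists_isLiftedGeodesicOn_univ_of_inwardBoundary
  have hend' : (z' ℓ, ζ' ℓ) = p'.1.2 :=
    ((hgeod'.mono (subset_univ _)).eqOn hgeod (left_mem_Icc.2 hℓ.le) (h₀'.trans h₀.symm) ℓ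
      (right_mem_Icc.2 hℓ.le)).trans hend
  refine classicalScattering_iff.2 ⟨p.1.1, z', ζ', hgeod',
    hflat.tendsToBackward_incomingEndpoint (hgeod'.mono (subset_univ _)) h₀', ?_⟩
  rw [← ht] at hflat hgeod' ⊢
  exact hflat.tendsToForward_outgoingEndpoint (hgeod'.mono (subset_univ _)) hend'

theorem IsFlatOutsideBall.truncatedScattering_of_classicalScattering
    (hflat : g.IsFlatOutsideBall p.1.1 R)
    (h : g.ClassicalScattering (incomingEndpoint p) (outgoingEndpoint p')) :
    g.TruncatedScattering T R p p' := by
  obtain ⟨t, z, ζ, hgeod, hback, hforw⟩ := classicalScattering_iff.1 h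
  obtain rfl : p.1.1 = t := mul_left_cancel₀ (by norm_num) hback.2.2.1
  obtain ⟨σ, hσ⟩ := hflat.exists_eq_of_tendsToBackward_incomingEndpoint hgeod hback
  have hshift := hgeod.comp_add σ
  have hforw_shift := hforw.comp (tendsto_atTop_add_const_right atTop σ tendsto_id)
  obtain ⟨b, hRb, hb⟩ :=
    ((hforw_shift.1.eventually_ge_atTop R).and (eventually_gt_atTop 0)).exists
  obtain ⟨p'', ℓ, hℓ, hscat, hend⟩ :=
    hflat.exists_truncatedScattering hshift (by simpa using hσ) ⟨b, hb, hRb⟩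
  have ht : p''.1.1 = p.1.1 := hscat.1
  rw [← ht] at hflat hshift hforw_shift
  have hforw'' := hflat.tendsToForward_outgoingEndpoint (hshift.mono (subset_univ _)) hend
  obtain rfl : p'' = p' := outgoingEndpoint_injective (hforw''.unique hforw_shift)
  exact hscat

theorem IsFlatOutsideBall.exists_truncatedScattering_of_nonTrapping
    (hflat : g.IsFlatOutsideBall p.1.1 R) (hnt : g.NonTrapping) :
    ∃ p', g.TruncatedScattering T R p p' := by
  obtain ⟨z, ζ, h₀, h⟩ := hflat.exists_isLiftedGeodesicOn_univ_of_inwardBoundary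
  obtain ⟨b, hb, hout⟩ := hnt p.1.1 z ζ h _ (isCompact_closedBall 0 R)
  have hexit : R ≤ ‖z b‖ := by
    rw [mem_closedBall_zero_iff, not_le] at hout
    exact hout.le
  obtain ⟨p', -, -, hscat, -⟩ := hflat.exists_truncatedScattering h h₀ ⟨b, hb, hexit⟩
  exact ⟨p', hscat⟩

end Scattering

end MetricFamily

theorem mainTheorem5_general {n : ℕ} {T R : ℝ} {g₁ g₂ : MetricFamily n}
    (hflat₁ : ∀ t ∈ Icc (-T) T, g₁.IsFlatOutsideBall t R)
    (hflat₂ : ∀ t ∈ Icc (-T) T, g₂.IsFlatOutsideBall t R) (hnt₁ : g₁.NonTrapping)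
    (hCl : ∀ q q', g₁.ClassicalScattering q q' → g₂.ClassicalScattering q q') :
    ∃ ClR : InwardBoundary n T R → OutwardBoundary n T R,
      (∀ p p', g₁.TruncatedScattering T R p p' ↔ p' = ClR p) ∧
      (∀ p p', g₂.TruncatedScattering T R p p' ↔ p' = ClR p) := by
  have hscat₁ (p : InwardBoundary n T R) : ∃ p', g₁.TruncatedScattering T R p p' :=
    (hflat₁ p.1.1 p.2.1).exists_truncatedScattering_of_nonTrapping hnt₁
  choose ClR hClR₁ using hscat₁
  have hClR₂ (p : InwardBoundary n T R) : g₂.TruncatedScattering T R p (ClR p) :=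
    (hflat₂ p.1.1 p.2.1).truncatedScattering_of_classicalScattering <| hCl _ _ <|
      (hflat₁ p.1.1 p.2.1).classicalScattering_of_truncatedScattering (hClR₁ p)
  exact ⟨ClR, fun p p' ↦ ⟨fun h ↦ h.unique (hClR₁ p), fun h ↦ h ▸ hClR₁ p⟩,
    fun p p' ↦ ⟨fun h ↦ h.unique (hClR₂ p), fun h ↦ h ▸ hClR₂ p⟩⟩

theorem mainTheorem5 {n : ℕ} (T R : ℝ) (hT : 0 < T) (hR : 0 < R) (g₁ g₂ : MetricFamily n)
    (hflat₁ : g₁.IsFlatOutside T R) (hflat₂ : g₂.IsFlatOutside T R)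
    (hnt₁ : g₁.NonTrapping) (hnt₂ : g₂.NonTrapping)
    (hCl : ∀ q q' : OneCuspBoundary n,
      g₁.ClassicalScattering q q' ↔ g₂.ClassicalScattering q q') :
    ∃ ClR : InwardBoundary n T R → OutwardBoundary n T R,
      (∀ p p', g₁.TruncatedScattering T R p p' ↔ p' = ClR p) ∧
      (∀ p p', g₂.TruncatedScattering T R p p' ↔ p' = ClR p) :=
  mainTheorem5_general (fun t _ z hz ↦ hflat₁ t z (.inl hz)) (fun t _ z hz ↦ hflat₂ t z (.inl hz))
    hnt₁ fun q q' ↦ (hCl q q').1
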